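/- All graphs are finite and simple. For a graph $G$ let $\alpha(G)$ be its independence number (the largest size of a set of pairwise non-adjacent vertices) and let $V_i(G)$ be the set of vertices of degree $i$ in $G$. Let $\mathcal{G}$ be the class of connected graphs of maximum degree at most $3$ on at least three vertices that are not isomorphic to $K_4$. Let $\mathcal{A}$ be the smallest class of graphs (up to isomorphism) such that $K_3\in\mathcal{A}$ and such that, whenever $G'\in\mathcal{A}$ and $x\in V_2(G')$, the graph obtained from the disjoint union of $G'$ and $K_3$ by adding an edge between $x$ and a vertex of $K_3$ belongs to $\mathcal{A}$. Let $\mathcal{B}$ be the class of graphs (up to isomorphism) obtained from a path on $n\ge 2$ vertices by attaching one pendant edge (to a new vertex of degree $1$) at every vertex of the path. **Theorem 3.** Let $\frac57\le c_1\le 1$. For every $G\in\mathcal{G}$, $$\alpha(G)\ \ge\ c_1|V_1(G)|+\tfrac37|V_2(G)|+(1-c_1)|V_3(G)|-\left(2c_1-\tfrac87\right).$$ Equality holds for every $G\in\mathcal{B}$. Moreover, if $c_1=\frac57$, then equality also holds for every $G\in\mathcal{A}$. -/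

import Mathlib

namespace SubcubicIndep

universe u

/-- The number `|V_i(G)|` of vertices of degree `i` in the finite graph `G`. -/
def numDeg {V : Type*} [Fintype V] (G : SimpleGraph V) [DecidableRel G.Adj] (i : ℕ) : ℕ :=
  (Finset.univ.filter fun v : V => G.degree v = i).card

/-- The class `𝒢`: connected finite graphs of maximum degree at most three, on at least three
vertices and not isomorphic to `K₄`. -/
structure ClassG {V : Type*} [Fintype V] (G : SimpleGraph V) [DecidableRel G.Adj] : Prop where
  connected : G.Connected
  subcubic : ∀ v, G.degree v ≤ 3
  three_le_card : 3 ≤ Fintype.card V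
  not_K4 : ¬ Nonempty (G ≃g (⊤ : SimpleGraph (Fin 4)))

/-- The disjoint union of `G` and `K₃`, together with one further edge that joins the vertex `x`
of `G` to the vertex `u` of `K₃`. -/
def attachTriangle {V : Type*} (G : SimpleGraph V) (x : V) (u : Fin 3) :
    SimpleGraph (V ⊕ Fin 3) :=
  (G ⊕g (⊤ : SimpleGraph (Fin 3))) ⊔ SimpleGraph.edge (Sum.inl x) (Sum.inr u)

/-- The class `𝒜` (closed under isomorphism): it contains `K₃`, and with `G'` it contains every
graph that arises from the disjoint union of `G'` and `K₃` by adding an edge between a vertex `x`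
of degree two in `G'` and a vertex of `K₃`. -/
inductive ClassA : ∀ {V : Type u}, SimpleGraph V → Prop
  | triangle {V : Type u} (G : SimpleGraph V)
      (e : Nonempty (G ≃g (⊤ : SimpleGraph (Fin 3)))) : ClassA G
  | attach {V W : Type u} (G' : SimpleGraph V) (G : SimpleGraph W) (hG' : ClassA G')
      (x : V) [Fintype (G'.neighborSet x)] (hx : G'.degree x = 2) (u : Fin 3)
      (e : Nonempty (G ≃g attachTriangle G' x u)) : ClassA G

/-- The graph obtained from `H` by adding, for every vertex `v` of `H`, a new vertex `Sum.inr v`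
that is joined to `v` only. -/
def addPendantEdges {V : Type*} (H : SimpleGraph V) : SimpleGraph (V ⊕ V) :=
  (H ⊕g (⊥ : SimpleGraph V)) ⊔
    SimpleGraph.fromRel fun a b => ∃ v : V, a = Sum.inl v ∧ b = Sum.inr v

/-- The class `ℬ` (closed under isomorphism): paths on `n ≥ 2` vertices with a pendant edge added
at every vertex. -/
def ClassB {V : Type*} (G : SimpleGraph V) : Prop :=
  ∃ n : ℕ, 2 ≤ n ∧ Nonempty (G ≃g addPendantEdges (SimpleGraph.pathGraph n))

end SubcubicIndep

namespace SubcubicIndep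

open Finset

/-! ### Independent sets measured against an acyclic subgraph -/

section
variable {V : Type*} {G F : SimpleGraph V}

/-! Write `n`, `m` for the numbers of vertices and edges, `nᵢ` for the number of vertices of degree
`i`. Everything rests on `7 α + 2 m + 2 ≥ 5 n + n₁`, which is `exists_isIndepSet_of_isAcyclic`
applied to a spanning tree: the `m - n + 1` edges off the tree cost two each. Counting degrees turns
it into the case `c = 5/7`. Connectedness also gives `m ≥ n - 1`, that is `n₁ ≤ n₃ + 2`, and adding
`c - 5/7` times this inequality yields every larger `c`. For equality, attaching a triangle
preserves `7 α + 2 m + 2 = 5 n`, and in a path with pendant edges `α` is the number of path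
vertices. -/

/-- In an acyclic graph, every nonempty finite vertex set contains a vertex with at most one
neighbour in the set. -/
lemma exists_card_filter_adj_le_one [DecidableRel F.Adj] (hF : F.IsAcyclic) {S : Finset V}
    (hS : S.Nonempty) : ∃ u ∈ S, #{w ∈ S | F.Adj u w} ≤ 1 := by
  classical
  have hne : Nonempty S := hS.to_subtype
  have hacyc : (F.induce (S : Set V)).IsAcyclic := hF.induce _
  -- Extend the induced forest to a spanning tree of the complete graph on `S`; a leaf of that tree
  -- serves.
  obtain ⟨T, hle, -, hT⟩ : ∃ T : SimpleGraph S, F.induce (S : Set V) ≤ T ∧ T ≤ ⊤ ∧ T.IsTree :=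
    SimpleGraph.connected_top.exists_isTree_le_of_le_of_isAcyclic le_top hacyc
  obtain ⟨u, hu⟩ : ∃ u, T.degree u ≤ 1 := by
    rcases subsingleton_or_nontrivial S with h | h
    · refine ⟨Classical.arbitrary _, ?_⟩
      exact (T.degree_lt_card_verts _).le.trans (Fintype.card_le_one_iff_subsingleton.mpr h)
    · obtain ⟨v, hv⟩ := hT.exists_vert_degree_one_of_nontrivial
      exact ⟨v, hv.le⟩
  refine ⟨u, u.2, le_trans ?_ hu⟩
  rw [← SimpleGraph.card_neighborFinset_eq_degree, ← card_map (Function.Embedding.subtype (· ∈ S))]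
  refine card_le_card fun w hw => ?_
  rw [mem_filter] at hw
  simp only [mem_map, SimpleGraph.mem_neighborFinset]
  exact ⟨⟨w, hw.1⟩, hle hw.2, rfl⟩

variable (H : SimpleGraph V) [DecidableRel H.Adj]

lemma sum_card_filter_adj_mono {S T : Finset V} (h : T ⊆ S) :
    ∑ v ∈ T, #{w ∈ T | H.Adj v w} ≤ ∑ v ∈ S, #{w ∈ S | H.Adj v w} :=
  (sum_le_sum fun _ _ => card_le_card (filter_subset_filter _ h)).trans
    (sum_le_sum_of_subset h)

lemma sum_card_filter_adj_erase [DecidableEq V] {S : Finset V} {u : V} (hu : u ∈ S) :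
    ∑ v ∈ S.erase u, #{w ∈ S.erase u | H.Adj v w} + 2 * #{w ∈ S | H.Adj u w} =
      ∑ v ∈ S, #{w ∈ S | H.Adj v w} := by
  have h1 : ∀ v, #{w ∈ S | H.Adj v w} =
      #{w ∈ S.erase u | H.Adj v w} + if H.Adj v u then 1 else 0 := by
    intro v
    simp only [card_filter]
    rw [← sum_erase_add _ _ hu]
  have h2 : #{w ∈ S | H.Adj u w} = ∑ v ∈ S.erase u, if H.Adj v u then 1 else 0 := by
    rw [h1 u, card_filter]
    simp [H.adj_comm u]
  rw [← sum_erase_add _ _ hu, sum_congr rfl fun v _ => h1 v, sum_add_distrib, ← h2]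
  ring

/-- The independence bound for a vertex set `S` of a graph `G` with an acyclic subgraph `F`: the
vertices of `S` count three each, pairwise non-adjacent vertices of degree at most one count one
more, and each edge outside of `F` is charged two. -/
theorem exists_isIndepSet_of_isAcyclic [DecidableEq V] [DecidableRel G.Adj] [DecidableRel F.Adj]
    (hF : F.IsAcyclic) (S L : Finset V) (hLS : L ⊆ S)
    (hdeg : ∀ x ∈ L, #{w ∈ S | G.Adj x w} ≤ 1) (hL : G.IsIndepSet L) :
    ∃ I ⊆ S, G.IsIndepSet I ∧
      3 * #S + #L ≤ 7 * #I + ∑ v ∈ S, #{w ∈ S | (G \ F).Adj v w} := by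
  induction S using Finset.strongInduction generalizing L with
  | H S ih =>
  -- Put `u` into `I` and delete its closed neighbourhood: with `d` neighbours this loses `3 (d +
  -- 1)` plus the deleted part of `L`, and gains `7`. Truncating the difference only weakens the
  -- bound. The charges of the edges at `u` remain available.
  have hclosed : ∀ u ∈ S, ∃ I ⊆ S, G.IsIndepSet I ∧
      3 * #S + #L ≤ 7 * #I + ∑ v ∈ S.erase u, #{w ∈ S.erase u | (G \ F).Adj v w} +
        (3 * #{w ∈ S | G.Adj u w} + #(L ∩ insert u {w ∈ S | G.Adj u w}) - 4) := by
    intro u hu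
    set N := {w ∈ S | G.Adj u w} with hN
    have huN : u ∉ N := by simp [hN]
    have hX : insert u N ⊆ S := insert_subset hu (filter_subset _ _)
    obtain ⟨I, hIS, hI, hcard⟩ := ih (S \ insert u N)
      (sdiff_ssubset hX (insert_nonempty _ _)) (L \ insert u N) (sdiff_subset_sdiff hLS le_rfl)
      (fun x hx => (card_le_card (filter_subset_filter _ sdiff_subset)).trans
        (hdeg x (mem_sdiff.mp hx).1))
      (hL.mono (by simp))
    have huI : u ∉ I := fun h => by simpa using hIS h
    have hmono := sum_card_filter_adj_mono (G \ F) (T := S \ insert u N) (S := S.erase u)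
      (fun x hx => by
        simp only [mem_sdiff, mem_insert, not_or] at hx
        exact mem_erase.mpr ⟨hx.2.1, hx.1⟩)
    refine ⟨insert u I, insert_subset hu (hIS.trans sdiff_subset), ?_, ?_⟩
    · rw [coe_insert]
      have hnadj : ∀ x ∈ I, ¬ G.Adj u x := fun x hx h => by
        have := mem_sdiff.mp (hIS hx)
        exact this.2 (mem_insert_of_mem (mem_filter.mpr ⟨this.1, h⟩))
      exact Set.Pairwise.insert hI fun x hx _ => ⟨hnadj x hx, fun h => hnadj x hx h.symm⟩
    · have e1 : #(S \ insert u N) + (#N + 1) = #S := by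
        rw [← card_insert_of_notMem huN, card_sdiff_add_card_eq_card hX]
      have e2 := card_sdiff_add_card_inter L (insert u N)
      rw [card_insert_of_notMem huI]
      omega
  by_cases hA : ∃ u ∈ S, #{w ∈ S | G.Adj u w} ≤ 1
  · obtain ⟨u, hu, hu1⟩ := hA
    obtain ⟨I, hIS, hI, hcard⟩ := hclosed u hu
    refine ⟨I, hIS, hI, ?_⟩
    -- The loss is then at most `3 + 1 - 4 = 0`.
    have hLX : #(L ∩ insert u {w ∈ S | G.Adj u w}) ≤ 1 := by
      have key : ∀ a ∈ L, ∀ b ∈ L, a = u → b ∈ S → ¬ G.Adj u b := by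
        rintro a ha b hb rfl _ h
        exact hL ha hb h.ne h
      rw [card_le_one]
      intro a ha b hb
      simp only [mem_inter, mem_insert, mem_filter] at ha hb
      rcases ha with ⟨haL, rfl | ha⟩ <;> rcases hb with ⟨hbL, rfl | hb⟩
      · rfl
      · exact (key _ haL _ hbL rfl hb.1 hb.2).elim
      · exact (key _ hbL _ haL rfl ha.1 ha.2).elim
      · exact card_le_one.mp hu1 a (by simpa using ha) b (by simpa using hb)
    have := sum_card_filter_adj_erase (G \ F) hu
    omega
  · push Not at hA
    have hL0 : L = ∅ := by
      rw [eq_empty_iff_forall_notMem]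
      exact fun x hx => (hA x (hLS hx)).not_ge (hdeg x hx)
    subst hL0
    rcases S.eq_empty_or_nonempty with rfl | hS
    · exact ⟨∅, by simp⟩
    obtain ⟨u, hu, huF⟩ := exists_card_filter_adj_le_one hF hS
    have huG := hA u hu
    have hsplit : #{w ∈ S | G.Adj u w} ≤ #{w ∈ S | (G \ F).Adj u w} + #{w ∈ S | F.Adj u w} := by
      refine (card_le_card fun w hw => ?_).trans (card_union_le _ _)
      simp only [mem_union, mem_filter, SimpleGraph.sdiff_adj] at hw ⊢
      tauto
    have herase := sum_card_filter_adj_erase (G \ F) hu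
    -- Two edges at `u` outside `F` carry charge at least four, so discarding `u`, worth three, is
    -- affordable. Otherwise `u` has exactly two neighbours, one of them outside `F`; choosing `u`
    -- loses `3 * 2 - 4 = 2`, the charge of that edge.
    by_cases h2 : 2 ≤ #{w ∈ S | (G \ F).Adj u w}
    · obtain ⟨I, hIS, hI, hcard⟩ := ih (S.erase u) (erase_ssubset hu) ∅ (by simp) (by simp)
        (by simp)
      refine ⟨I, hIS.trans (erase_subset _ _), hI, ?_⟩
      have := card_erase_add_one hu
      simp only [card_empty] at hcard ⊢
      omega
    · obtain ⟨I, hIS, hI, hcard⟩ := hclosed u hu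
      refine ⟨I, hIS, hI, ?_⟩
      simp only [card_empty, empty_inter] at hcard ⊢
      omega

end

/-! ### The lower bound for connected graphs -/

section
variable {V : Type*} [Fintype V] {G : SimpleGraph V} [DecidableRel G.Adj]

/-- A degree-dependent weight summed over a graph all of whose degrees are `1`, `2` or `3`. -/
lemma sum_degree_eq_numDeg {M : Type*} [Semiring M] (f : ℕ → M)
    (h : ∀ v, 1 ≤ G.degree v ∧ G.degree v ≤ 3) :
    ∑ v, f (G.degree v) = f 1 * numDeg G 1 + f 2 * numDeg G 2 + f 3 * numDeg G 3 := by
  simp only [numDeg, card_filter, Nat.cast_sum, mul_sum, ← sum_add_distrib]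
  refine sum_congr rfl fun v _ => ?_
  obtain ⟨h1, h3⟩ := h v
  interval_cases G.degree v <;> simp

/-- Two adjacent leaves would form a whole component. This makes the set of leaves admissible as
`L`. -/
lemma not_adj_of_degree_eq_one (hG : G.Connected) (hcard : 3 ≤ Fintype.card V) {x y : V}
    (hx : G.degree x = 1) (hy : G.degree y = 1) : ¬ G.Adj x y := by
  classical
  intro hxy
  have key : ∀ {a b c : V}, G.degree a = 1 → G.Adj a b → G.Adj a c → c = b := by
    intro a b c ha hb hc
    rw [← SimpleGraph.card_neighborFinset_eq_degree] at ha
    exact card_le_one.mp ha.le c (by simpa) b (by simpa)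
  have hall : ∀ z, z = x ∨ z = y := by
    intro z
    obtain ⟨p⟩ := hG.preconnected z x
    induction p with
    | nil => exact Or.inl rfl
    | cons h p ih =>
      rcases ih hx hxy with rfl | rfl
      · exact Or.inr (key hx hxy h.symm)
      · exact Or.inl (key hy hxy.symm h.symm)
  have : Fintype.card V ≤ 2 := by
    rw [← card_univ]
    exact (card_le_card fun z _ => by simpa using hall z).trans (card_le_two (a := x) (b := y))
  omega

/-- Every connected graph on at least three vertices satisfies
`7 α ≥ 5 n + n₁ - 2 m - 2`, where `n₁` is the number of its leaves. -/
theorem five_mul_card_add_numDeg_one_le (hG : G.Connected) (hcard : 3 ≤ Fintype.card V) :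
    5 * Fintype.card V + numDeg G 1 ≤ 7 * G.indepNum + ∑ v, G.degree v + 2 := by
  classical
  obtain ⟨T, hTG, hT⟩ := hG.exists_isTree_le
  have hfilter : ∀ (H : SimpleGraph V) [DecidableRel H.Adj] (v : V),
      #{w ∈ univ | H.Adj v w} = H.degree v := by
    intro H _ v
    rw [← SimpleGraph.card_neighborFinset_eq_degree, SimpleGraph.neighborFinset_eq_filter]
  obtain ⟨I, -, hI, hb⟩ := exists_isIndepSet_of_isAcyclic (G := G) hT.isAcyclic univ
    {v | G.degree v = 1} (subset_univ _)
    (fun x hx => by rw [hfilter G x]; exact (mem_filter.mp hx).2.le)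
    (fun x hx y hy _ => not_adj_of_degree_eq_one hG hcard (by simpa using hx) (by simpa using hy))
  have hsum : ∑ v, #{w ∈ univ | (G \ T).Adj v w} + ∑ v, T.degree v = ∑ v, G.degree v := by
    rw [← sum_add_distrib]
    refine sum_congr rfl fun v _ => ?_
    rw [← hfilter G, ← hfilter T, ← card_union_of_disjoint]
    · congr 1
      ext w
      have := @hTG v w
      simp only [mem_union, mem_filter, SimpleGraph.sdiff_adj]
      tauto
    · exact disjoint_filter.mpr fun w _ h => ((SimpleGraph.sdiff_adj _ _ _ _).mp h).2
  have hT2 := T.sum_degrees_eq_twice_card_edges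
  have hT1 := hT.card_edgeFinset
  have hle := hI.card_le_indepNum
  rw [card_univ] at hb
  change _ + numDeg G 1 ≤ _ at hb
  omega

theorem ClassG.le_indepNum (h : ClassG G) {c : ℝ} (hc : 5 / 7 ≤ c) :
    c * numDeg G 1 + 3 / 7 * numDeg G 2 + (1 - c) * numDeg G 3 - (2 * c - 8 / 7) ≤ G.indepNum := by
  have hcard := h.three_le_card
  have : Nontrivial V := Fintype.one_lt_card_iff_nontrivial.mp (by omega)
  have hd : ∀ v, 1 ≤ G.degree v ∧ G.degree v ≤ 3 := fun v =>
    ⟨h.connected.preconnected.degree_pos_of_nontrivial v, h.subcubic v⟩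
  have hn := sum_degree_eq_numDeg (fun _ => 1) hd
  have hm := sum_degree_eq_numDeg (fun d => d) hd
  have hb := five_mul_card_add_numDeg_one_le h.connected hcard
  have htree := h.connected.card_vert_le_card_edgeSet_add_one
  rw [Nat.card_eq_fintype_card, Nat.card_eq_fintype_card, SimpleGraph.card_edgeSet] at htree
  have htwo := G.sum_degrees_eq_twice_card_edges
  simp only [sum_const, card_univ, smul_eq_mul, mul_one, one_mul, Nat.cast_id] at hn hm
  have h1 : 5 * numDeg G 1 + 3 * numDeg G 2 + 2 * numDeg G 3 ≤ 7 * G.indepNum + 2 := by omega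
  have h2 : numDeg G 1 ≤ numDeg G 3 + 2 := by omega
  have h1' : (5 * numDeg G 1 + 3 * numDeg G 2 + 2 * numDeg G 3 : ℝ) ≤ 7 * G.indepNum + 2 := by
    exact_mod_cast h1
  have h2' : (numDeg G 1 : ℝ) ≤ numDeg G 3 + 2 := by exact_mod_cast h2
  nlinarith [mul_nonneg (sub_nonneg.mpr hc) (sub_nonneg.mpr h2')]

end

/-! ### Invariance under isomorphism -/

section
variable {V W : Type*} [Fintype V] [Fintype W] {G : SimpleGraph V} {H : SimpleGraph W}
  [DecidableRel G.Adj] [DecidableRel H.Adj]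

lemma degree_iso_apply (e : G ≃g H) (v : V) : H.degree (e v) = G.degree v := by
  rw [← SimpleGraph.card_neighborSet_eq_degree, ← SimpleGraph.card_neighborSet_eq_degree]
  exact Fintype.card_congr (e.mapNeighborSet v).symm

lemma numDeg_eq_of_iso (e : G ≃g H) (i : ℕ) : numDeg G i = numDeg H i := by
  simp only [numDeg, card_filter]
  exact Fintype.sum_equiv e.toEquiv _ _ fun v => by
    rw [← degree_iso_apply e v]; rfl

omit [Fintype V] [DecidableRel G.Adj] [DecidableRel H.Adj] in
lemma indepNum_le_of_embedding (e : G ↪g H) : G.indepNum ≤ H.indepNum := by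
  obtain ⟨s, hs, hcard⟩ := G.exists_isNIndepSet_indepNum
  rw [← hcard, ← card_map e.toEmbedding]
  apply SimpleGraph.IsIndepSet.card_le_indepNum
  intro a ha b hb hab
  simp only [coe_map, Set.mem_image] at ha hb
  obtain ⟨a, ha, rfl⟩ := ha
  obtain ⟨b, hb, rfl⟩ := hb
  intro h
  exact hs ha hb (fun h => hab (h ▸ rfl)) (e.map_adj_iff.mp h)

omit [DecidableRel G.Adj] [DecidableRel H.Adj] in
lemma indepNum_eq_of_iso (e : G ≃g H) : G.indepNum = H.indepNum :=
  (indepNum_le_of_embedding e.toEmbedding).antisymm (indepNum_le_of_embedding e.symm.toEmbedding)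

end

/-! ### Pendant edges and the class `ℬ` -/

section
variable {V : Type*} (H : SimpleGraph V)

@[simp] lemma addPendantEdges_adj_inl_inl (v w : V) :
    (addPendantEdges H).Adj (.inl v) (.inl w) ↔ H.Adj v w := by
  simp [addPendantEdges]

@[simp] lemma addPendantEdges_adj_inl_inr (v w : V) :
    (addPendantEdges H).Adj (.inl v) (.inr w) ↔ v = w := by
  simp [addPendantEdges, eq_comm]

@[simp] lemma addPendantEdges_adj_inr_inl (v w : V) :
    (addPendantEdges H).Adj (.inr v) (.inl w) ↔ v = w := by
  simp [addPendantEdges, eq_comm]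

@[simp] lemma addPendantEdges_adj_inr_inr (v w : V) :
    ¬ (addPendantEdges H).Adj (.inr v) (.inr w) := by
  simp [addPendantEdges]

variable [Fintype V]

lemma degree_addPendantEdges_inl [DecidableRel H.Adj] [DecidableRel (addPendantEdges H).Adj]
    (v : V) : (addPendantEdges H).degree (.inl v) = H.degree v + 1 := by
  classical
  simp only [← SimpleGraph.card_neighborFinset_eq_degree, SimpleGraph.neighborFinset_eq_filter,
    card_filter, Fintype.sum_sum_type, addPendantEdges_adj_inl_inl, addPendantEdges_adj_inl_inr]
  simp

lemma degree_addPendantEdges_inr [DecidableRel (addPendantEdges H).Adj]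
    (v : V) : (addPendantEdges H).degree (.inr v) = 1 := by
  classical
  simp only [← SimpleGraph.card_neighborFinset_eq_degree, SimpleGraph.neighborFinset_eq_filter,
    card_filter, Fintype.sum_sum_type, addPendantEdges_adj_inr_inl, addPendantEdges_adj_inr_inr]
  simp

/-- The pendant edges form a perfect matching, so an independent set has at most one end of each;
the new vertices attain this. -/
lemma indepNum_addPendantEdges : (addPendantEdges H).indepNum = Fintype.card V := by
  classical
  apply le_antisymm
  · obtain ⟨s, hs, hcard⟩ := (addPendantEdges H).exists_isNIndepSet_indepNum
    rw [← hcard, ← card_univ]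
    refine card_le_card_of_injOn (Sum.elim id id) (by simp) ?_
    rintro (a | a) ha (b | b) hb (rfl : a = b)
    · rfl
    · exact (hs ha hb (by simp) (by simp)).elim
    · exact (hs ha hb (by simp) (by simp)).elim
    · rfl
  · rw [← card_univ, ← card_map Function.Embedding.inr]
    apply SimpleGraph.IsIndepSet.card_le_indepNum
    simp [Set.Pairwise, SimpleGraph.IsIndepSet]

end

lemma pathGraph_degree_pos_and_le_two {n : ℕ} [DecidableRel (SimpleGraph.pathGraph n).Adj]
    (hn : 2 ≤ n) (v : Fin n) :
    1 ≤ (SimpleGraph.pathGraph n).degree v ∧ (SimpleGraph.pathGraph n).degree v ≤ 2 := by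
  obtain ⟨m, rfl⟩ : ∃ m, n = m + 1 := ⟨n - 1, by omega⟩
  have : Nontrivial (Fin (m + 1)) := Fin.nontrivial_iff_two_le.mpr hn
  refine ⟨(SimpleGraph.pathGraph_preconnected _).degree_pos_of_nontrivial v, ?_⟩
  rw [← SimpleGraph.card_neighborFinset_eq_degree, ← card_map Fin.valEmbedding]
  refine (card_le_card (t := {v.val - 1, v.val + 1}) fun x hx => ?_).trans card_le_two
  simp only [mem_map, SimpleGraph.mem_neighborFinset, SimpleGraph.pathGraph_adj,
    Fin.valEmbedding_apply] at hx
  obtain ⟨w, hw, rfl⟩ := hx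
  simp only [mem_insert, mem_singleton]
  omega

lemma sum_degree_pathGraph (n : ℕ) [DecidableRel (SimpleGraph.pathGraph n).Adj] :
    ∑ v, (SimpleGraph.pathGraph n).degree v = 2 * (n - 1) := by
  have hdeg : ∀ v : Fin n, (SimpleGraph.pathGraph n).degree v =
      #{w : Fin n | v.val + 1 = w.val} + #{w : Fin n | w.val + 1 = v.val} := by
    intro v
    rw [← SimpleGraph.card_neighborFinset_eq_degree, SimpleGraph.neighborFinset_eq_filter,
      ← card_union_of_disjoint, ← filter_or]
    · simp [SimpleGraph.pathGraph_adj]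
    · exact disjoint_filter.mpr fun w _ h => by omega
  have hcount : ∑ v : Fin n, #{w : Fin n | w.val + 1 = v.val} = n - 1 := by
    have : ∀ v : Fin n, #{w : Fin n | w.val + 1 = v.val} = if v.val ≠ 0 then 1 else 0 := by
      intro v
      split_ifs with h
      · rw [card_eq_one]
        refine ⟨⟨v - 1, by omega⟩, ?_⟩
        ext w
        simp only [mem_filter, mem_univ, true_and, mem_singleton, Fin.ext_iff]
        omega
      · rw [card_eq_zero, filter_eq_empty_iff]
        intro w _
        omega
    rw [sum_congr rfl fun v _ => this v]
    cases n with
    | zero => rfl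
    | succ n => simp [Fin.sum_univ_succ]
  have hcomm : ∑ v : Fin n, #{w : Fin n | v.val + 1 = w.val} =
      ∑ v : Fin n, #{w : Fin n | w.val + 1 = v.val} := by
    simp only [card_filter]
    exact sum_comm
  rw [sum_congr rfl fun v _ => hdeg v, sum_add_distrib, hcomm, hcount, two_mul]

theorem ClassB.indepNum_eq {V : Type*} [Fintype V] {G : SimpleGraph V} [DecidableRel G.Adj]
    (h : ClassB G) (c : ℝ) : (G.indepNum : ℝ) =
      c * numDeg G 1 + 3 / 7 * numDeg G 2 + (1 - c) * numDeg G 3 - (2 * c - 8 / 7) := by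
  classical
  obtain ⟨n, hn, ⟨e⟩⟩ := h
  set P := SimpleGraph.pathGraph n
  have hP : ∀ v, 1 ≤ P.degree v ∧ P.degree v ≤ 2 := pathGraph_degree_pos_and_le_two hn
  have hd : ∀ v, 1 ≤ (addPendantEdges P).degree v ∧ (addPendantEdges P).degree v ≤ 3 := by
    rintro (v | v)
    · rw [degree_addPendantEdges_inl]
      have := hP v
      omega
    · simp [degree_addPendantEdges_inr]
  rw [indepNum_eq_of_iso e, numDeg_eq_of_iso e, numDeg_eq_of_iso e, numDeg_eq_of_iso e,
    indepNum_addPendantEdges, Fintype.card_fin]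
  -- Path degrees are only `1` and `2`, so the weight is affine in the degree and its sum needs only
  -- the degree sum of the path.
  have hw : ∀ v, (fun d : ℕ => if d = 1 then c else if d = 2 then 3 / 7 else 1 - c)
      (P.degree v + 1) = (4 / 7 - c) * P.degree v + (c - 1 / 7) := by
    intro v
    obtain ⟨h1, h2⟩ := hP v
    interval_cases P.degree v
    · norm_num
    · norm_num
      ring
  have hsum := sum_degree_eq_numDeg
    (fun d : ℕ => if d = 1 then c else if d = 2 then 3 / 7 else 1 - c) hd
  have hPsum : (∑ v, (P.degree v : ℝ)) = 2 * (n - 1) := by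
    have := sum_degree_pathGraph n
    rw [← Nat.cast_sum, this]
    push_cast [Nat.cast_sub (show 1 ≤ n by omega)]
    ring
  rw [Fintype.sum_sum_type] at hsum
  simp only [degree_addPendantEdges_inl, degree_addPendantEdges_inr] at hsum
  rw [sum_congr rfl fun v _ => hw v, sum_add_distrib, ← mul_sum, hPsum] at hsum
  norm_num at hsum
  linarith

-- Attached triangles and the class `𝒜`

universe u

section
variable {V : Type*} (G : SimpleGraph V) (x : V) (t : Fin 3)

@[simp] lemma attachTriangle_adj_inl_inl (v w : V) :
    (attachTriangle G x t).Adj (.inl v) (.inl w) ↔ G.Adj v w := by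
  simp [attachTriangle, SimpleGraph.edge_adj]

@[simp] lemma attachTriangle_adj_inl_inr (v : V) (i : Fin 3) :
    (attachTriangle G x t).Adj (.inl v) (.inr i) ↔ v = x ∧ i = t := by
  simp [attachTriangle, SimpleGraph.edge_adj]

@[simp] lemma attachTriangle_adj_inr_inl (v : V) (i : Fin 3) :
    (attachTriangle G x t).Adj (.inr i) (.inl v) ↔ v = x ∧ i = t := by
  rw [SimpleGraph.adj_comm, attachTriangle_adj_inl_inr]

@[simp] lemma attachTriangle_adj_inr_inr (i j : Fin 3) :
    (attachTriangle G x t).Adj (.inr i) (.inr j) ↔ i ≠ j := by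
  simp [attachTriangle, SimpleGraph.edge_adj]

variable [Fintype V] [DecidableRel (attachTriangle G x t).Adj]

lemma degree_attachTriangle_inl [DecidableEq V] [DecidableRel G.Adj] (v : V) :
    (attachTriangle G x t).degree (.inl v) = G.degree v + if v = x then 1 else 0 := by
  simp only [← SimpleGraph.card_neighborFinset_eq_degree, SimpleGraph.neighborFinset_eq_filter,
    card_filter, Fintype.sum_sum_type, attachTriangle_adj_inl_inl, attachTriangle_adj_inl_inr]
  by_cases h : v = x <;> simp [h]

lemma degree_attachTriangle_inr (i : Fin 3) :
    (attachTriangle G x t).degree (.inr i) = 2 + if i = t then 1 else 0 := by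
  classical
  simp only [← SimpleGraph.card_neighborFinset_eq_degree, SimpleGraph.neighborFinset_eq_filter,
    card_filter, Fintype.sum_sum_type, attachTriangle_adj_inr_inl, attachTriangle_adj_inr_inr]
  have : ∑ j : Fin 3, (if i ≠ j then 1 else 0) = 2 := by revert i; decide
  rw [this, add_comm]
  by_cases h : i = t <;> simp [h]

omit [DecidableRel (attachTriangle G x t).Adj] in
lemma indepNum_attachTriangle : (attachTriangle G x t).indepNum = G.indepNum + 1 := by
  classical
  apply le_antisymm
  · obtain ⟨s, hs, hcard⟩ := (attachTriangle G x t).exists_isNIndepSet_indepNum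
    rw [← hcard, ← card_toLeft_add_card_toRight]
    refine add_le_add (SimpleGraph.IsIndepSet.card_le_indepNum fun a ha b hb hab h => ?_)
      (card_le_one.mpr fun i hi j hj => ?_)
    · simp only [mem_coe, mem_toLeft] at ha hb
      exact hs ha hb (by simpa using hab) (by simpa using h)
    · rw [mem_toRight] at hi hj
      by_contra hij
      exact hs hi hj (by simpa using hij) (by simpa using hij)
  · obtain ⟨s, hs, hcard⟩ := G.exists_isNIndepSet_indepNum
    -- A triangle vertex other than `t` has no neighbour in `G`, so it extends any independent set
    -- of `G`.
    have ht : t + 1 ≠ t := by revert t; decide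
    rw [← hcard, ← card_singleton (t + 1), ← card_disjSum]
    apply SimpleGraph.IsIndepSet.card_le_indepNum
    rintro (a | a) ha (b | b) hb hab
    · simp only [mem_coe, inl_mem_disjSum] at ha hb
      simpa using hs ha hb (by simpa using hab)
    · have hb' : b = t + 1 := by simpa using hb
      simp [hb', ht]
    · have ha' : a = t + 1 := by simpa using ha
      simp [ha', ht]
    · have ha' : a = t + 1 := by simpa using ha
      have hb' : b = t + 1 := by simpa using hb
      simp [ha', hb']

end

/-- One attachment adds `7` to `7 α`, `8` to the degree sum and `15` to `5 n`. Joining at a vertex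
of degree two keeps the degrees in range. -/
theorem ClassA.indepNum_add_sum_degree {V : Type u} {G : SimpleGraph V} (h : ClassA G) :
    ∀ [Fintype V] [DecidableRel G.Adj], (∀ v, 2 ≤ G.degree v ∧ G.degree v ≤ 3) ∧
      7 * G.indepNum + 2 + ∑ v, G.degree v = 5 * Fintype.card V := by
  classical
  induction h with
  | triangle G e =>
    intro _ _
    obtain ⟨e⟩ := e
    have hdeg : ∀ v, G.degree v = 2 := fun v => by
      rw [← degree_iso_apply e v, SimpleGraph.complete_graph_degree, Fintype.card_fin]
    have hcard : Fintype.card _ = 3 := (Fintype.card_congr e.toEquiv).trans (Fintype.card_fin 3)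
    have hind : G.indepNum = 1 := by
      rw [indepNum_eq_of_iso e]
      apply le_antisymm
      · obtain ⟨s, hs, hs'⟩ := (⊤ : SimpleGraph (Fin 3)).exists_isNIndepSet_indepNum
        rw [← hs']
        refine card_le_one.mpr fun a ha b hb => ?_
        by_contra hab
        exact hs ha hb hab (by simpa using hab)
      · rw [← card_singleton (0 : Fin 3)]
        apply SimpleGraph.IsIndepSet.card_le_indepNum
        simp
    refine ⟨fun v => by simp [hdeg], ?_⟩
    simp [hdeg, hind, hcard]
  | @attach V' W G' G hG' x _ hx t e ih =>
    intro _ _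
    obtain ⟨e⟩ := e
    have : Fintype V' := by
      have := Fintype.ofEquiv W e.toEquiv
      exact Fintype.ofInjective (Sum.inl : V' → V' ⊕ Fin 3) Sum.inl_injective
    obtain ⟨hdeg, hsum⟩ := ih
    have hx' : ∀ v, v = x → G'.degree v = 2 := by
      rintro v rfl
      convert hx
    have hdeg' : ∀ v, 2 ≤ (attachTriangle G' x t).degree v ∧
        (attachTriangle G' x t).degree v ≤ 3 := by
      rintro (v | i)
      · rw [degree_attachTriangle_inl]
        have := hdeg v
        split_ifs with h
        · rw [hx' v h]
          omega
        · omega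
      · rw [degree_attachTriangle_inr]
        split_ifs <;> omega
    refine ⟨fun v => by rw [← degree_iso_apply e v]; exact hdeg' _, ?_⟩
    have hiso : ∑ v, G.degree v = ∑ v, (attachTriangle G' x t).degree v :=
      Fintype.sum_equiv e.toEquiv _ _ fun v => (degree_iso_apply e v).symm
    have hsum' : ∑ v, (attachTriangle G' x t).degree v = ∑ v, G'.degree v + 8 := by
      rw [Fintype.sum_sum_type]
      simp only [degree_attachTriangle_inl, degree_attachTriangle_inr, sum_add_distrib]
      simp [add_assoc]
    have hcard := Fintype.card_congr e.toEquiv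
    rw [Fintype.card_sum, Fintype.card_fin] at hcard
    rw [indepNum_eq_of_iso e, indepNum_attachTriangle, hiso, hsum', hcard]
    omega

theorem ClassA.indepNum_eq {V : Type*} [Fintype V] {G : SimpleGraph V} [DecidableRel G.Adj]
    (h : ClassA G) : (G.indepNum : ℝ) =
      5 / 7 * numDeg G 1 + 3 / 7 * numDeg G 2 + 2 / 7 * numDeg G 3 - 2 / 7 := by
  obtain ⟨hdeg, hsum⟩ := h.indepNum_add_sum_degree
  have hd : ∀ v, 1 ≤ G.degree v ∧ G.degree v ≤ 3 := fun v => ⟨by linarith [(hdeg v).1], (hdeg v).2⟩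
  have h1 : numDeg G 1 = 0 := by
    rw [numDeg, card_eq_zero, filter_eq_empty_iff]
    intro v _
    have := (hdeg v).1
    omega
  have hn := sum_degree_eq_numDeg (fun _ => 1) hd
  have hm := sum_degree_eq_numDeg (fun d => d) hd
  simp only [sum_const, card_univ, smul_eq_mul, mul_one, one_mul, Nat.cast_id] at hn hm
  have h2 : 7 * G.indepNum + 2 = 3 * numDeg G 2 + 2 * numDeg G 3 := by omega
  have h2' : (7 * G.indepNum + 2 : ℝ) = 3 * numDeg G 2 + 2 * numDeg G 3 := by exact_mod_cast h2
  rw [h1]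
  push_cast
  linarith

end SubcubicIndep

theorem theorem3 (c₁ : ℝ) (hc₁ : 5 / 7 ≤ c₁) (hc₁' : c₁ ≤ 1)
    {V : Type*} [Fintype V] (G : SimpleGraph V) [DecidableRel G.Adj] :
    (SubcubicIndep.ClassG G →
      (G.indepNum : ℝ) ≥ c₁ * SubcubicIndep.numDeg G 1 + 3 / 7 * SubcubicIndep.numDeg G 2
        + (1 - c₁) * SubcubicIndep.numDeg G 3 - (2 * c₁ - 8 / 7)) ∧
    (SubcubicIndep.ClassB G →
      (G.indepNum : ℝ) = c₁ * SubcubicIndep.numDeg G 1 + 3 / 7 * SubcubicIndep.numDeg G 2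
        + (1 - c₁) * SubcubicIndep.numDeg G 3 - (2 * c₁ - 8 / 7)) ∧
    (c₁ = 5 / 7 → SubcubicIndep.ClassA G →
      (G.indepNum : ℝ) = c₁ * SubcubicIndep.numDeg G 1 + 3 / 7 * SubcubicIndep.numDeg G 2
        + (1 - c₁) * SubcubicIndep.numDeg G 3 - (2 * c₁ - 8 / 7)) := by
  refine ⟨fun h => h.le_indepNum hc₁, fun h => h.indepNum_eq c₁, ?_⟩
  rintro rfl h
  rw [h.indepNum_eq]
  ring
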